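/- Let $(M,\mathcal S)$ be a model of $\mathsf{RCA}_0$: $M$ is a discretely ordered commutative semiring with identity, $\mathcal S$ is a collection of subsets of $M$, and $(M,\mathcal S)$ satisfies $\Sigma^0_1$ induction and $\Delta^0_1$ comprehension (with number and set parameters). We reason inside this arbitrary model; by the completeness theorem, the claim says exactly that $\mathsf{RCA}_0$ proves the equivalence below. Thus "$\mathbb N$" means $M$, "set" means a member of $\mathcal S$, functions are sets of coded pairs, $\mathcal P_{\mathrm f}(I)$ is the collection of codes of finite subsets of $I$, and a sequence $(U_i)_{i\in I}$ of subsets of $X$ is coded by the set of pairs $(x,i)$ with $i \in I$ and $x\in U_i$. A countable second-countable space is a triple $(X,\mathcal U,k)$ consisting of a set $X$, a sequence $\mathcal U=(U_i)_{i\in I}$ of subsets of $X$, and a function $k\colon X\times I\times I\to I$, such that each $x\in X$ lies in some $U_i$, and $x\in U_i\cap U_j$ implies $x\in U_{k(x,i,j)}\subseteq U_i\cap U_j$. For a set $X'\subseteq X$, the corresponding subspace is $(X',(U_i\cap X')_{i\in I},k\restriction (X'\times I\times I))$. A function $h\colon\mathbb N\to\mathcal P_{\mathrm f}(I)$ codes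 the effectively open set $G_h=\bigcup_{n\in\mathbb N}\bigcup_{i\in h(n)}U_i$ and the effectively closed set $F_h=X\setminus G_h$; these are definable collections that need not be sets of the model. A function $g\colon\mathbb N\times\mathbb N\to\mathcal P_{\mathrm f}(I)$ codes the sequence $(G_n)_{n\in\mathbb N}$ of effectively open sets $G_n=G_{g(n,\cdot)}$ and the sequence $(F_n)_{n\in\mathbb N}$ of effectively closed sets $F_n=F_{g(n,\cdot)}$. The space is compact if for every $h\colon\mathbb N\to\mathcal P_{\mathrm f}(I)$ with $X=G_h$ there is an $N\in\mathbb N$ with $X=\bigcup_{n<N}\bigcup_{i\in h(n)}U_i$. An effectively open set $G_h$ is compact if for every $f\colon\mathbb N\to\mathcal P_{\mathrm f}(I)$ with $G_h\subseteq G_f$ there is an $N\in\mathbb N$ with $G_h\subseteq\bigcup_{n<N}\bigcup_{i\in f(n)}U_i$. **Proposition 3.1** (over $\mathsf{RCA}_0$). For a countable second-countable space $(X,\mathcal U,k)$, the following statements are equivalent. (i) Every effectively open set is compact. (ii) For every effectively open set $G_h$, there is an $N\in\mathbb N$ such that $G_h=\bigcup_{n<N}\bigcup_{i\in h(n)}U_i$.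 (iii) Every subspace is compact. (iv) For every sequence $(G_n)_{n\in\mathbb N}$ of effectively open sets such that $\forall n\,(G_n\subseteq G_{n+1})$, there is an $N$ such that $(\forall n>N)(G_n=G_N)$. (v) For every sequence $(F_n)_{n\in\mathbb N}$ of effectively closed sets such that $\forall n\,(F_n\supseteq F_{n+1})$, there is an $N$ such that $(\forall n>N)(F_n=F_N)$. -/

import Mathlib

namespace RevMath

universe u

/-! ## The language of second-order arithmetic and the theory RCA₀

A structure for second-order arithmetic is a set `M` of numbers, here a commutative semiring with
a linear order, together with a nonempty family `S : Set (Set M)` of subsets of `M`, over which the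
set variables range. Provability in RCA₀ means, by completeness, truth in all of its models. -/

/-- Number terms; variables are de Bruijn indices. -/
inductive Term : Type
  | var : ℕ → Term
  | zero : Term
  | one : Term
  | add : Term → Term → Term
  | mul : Term → Term → Term

/-- Bounded-quantifier formulas, with free number variables and free set variables. In
`bex t φ` (meaning `∃ x < t, φ`) the variable `x` is the variable `0` of `φ`, the other number
variables are shifted by one in `φ`, and `t` does not contain `x`. The other connectives and the
bounded universal quantifier are obtained from these by negation. -/
inductive BddFormula : Type
  | eq : Term → Term → BddFormula
  | lt : Term → Term → BddFormula
  | mem : Term → ℕ → BddFormula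
  | neg : BddFormula → BddFormula
  | and : BddFormula → BddFormula → BddFormula
  | bex : Term → BddFormula → BddFormula

/-- The assignment `a, v 0, v 1, …`. -/
def push {M : Type u} (a : M) (v : ℕ → M) : ℕ → M
  | 0 => a
  | n + 1 => v n

/-- The value of a term under an assignment of the number variables. -/
def Term.eval {M : Type u} [CommSemiring M] (v : ℕ → M) : Term → M
  | .var n => v n
  | .zero => 0
  | .one => 1
  | .add t s => t.eval v + s.eval v
  | .mul t s => t.eval v * s.eval v

/-- Truth of a bounded-quantifier formula, under an assignment `A` of the set variables and an
assignment `v` of the number variables. -/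
def BddFormula.Realize {M : Type u} [CommSemiring M] [LinearOrder M] (A : ℕ → Set M) :
    BddFormula → (ℕ → M) → Prop
  | .eq t s, v => t.eval v = s.eval v
  | .lt t s, v => t.eval v < s.eval v
  | .mem t i, v => t.eval v ∈ A i
  | .neg φ, v => ¬ φ.Realize A v
  | .and φ ψ, v => φ.Realize A v ∧ ψ.Realize A v
  | .bex t φ, v => ∃ x, x < t.eval v ∧ φ.Realize A (push x v)

/-- The `Σ⁰₁` formula `∃ m, θ(m, n, …)`, evaluated at `n`; the remaining number variables
and the set variables are parameters. -/
def SigmaOne {M : Type u} [CommSemiring M] [LinearOrder M]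
    (θ : BddFormula) (A : ℕ → Set M) (v : ℕ → M) (n : M) : Prop :=
  ∃ m, θ.Realize A (push m (push n v))

/-- The `Π⁰₁` formula `∀ m, θ(m, n, …)`, evaluated at `n`. -/
def PiOne {M : Type u} [CommSemiring M] [LinearOrder M]
    (θ : BddFormula) (A : ℕ → Set M) (v : ℕ → M) (n : M) : Prop :=
  ∀ m, θ.Realize A (push m (push n v))

/-- `(M, S)` is a model of RCA₀: `M` is a discretely ordered commutative semiring with identity,
and `(M, S)` satisfies `Σ⁰₁` induction and `Δ⁰₁` comprehension, both with number parameters from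
`M` and set parameters from `S`. -/
structure IsModelRCA0 (M : Type u) [CommSemiring M] [LinearOrder M] [IsStrictOrderedRing M]
    (S : Set (Set M)) : Prop where
  /-- the sort of sets is nonempty, as is every sort of a structure -/
  nonempty : S.Nonempty
  discrete : ∀ a : M, 0 < a → 1 ≤ a
  induction : ∀ (θ : BddFormula) (A : ℕ → Set M) (v : ℕ → M), (∀ i, A i ∈ S) →
    SigmaOne θ A v 0 → (∀ n, SigmaOne θ A v n → SigmaOne θ A v (n + 1)) →
    ∀ n, SigmaOne θ A v n
  comprehension : ∀ (θ η : BddFormula) (A : ℕ → Set M) (v : ℕ → M), (∀ i, A i ∈ S) →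
    (∀ n, SigmaOne θ A v n ↔ PiOne η A v n) → {n | SigmaOne θ A v n} ∈ S

/-! ## Pairs, functions and finite sets inside second-order arithmetic -/

section Coding

variable {M : Type u} [CommSemiring M]

/-- The usual code of an ordered pair of numbers. -/
def pair (a b : M) : M := (a + b) ^ 2 + a

/-- `A × B`, as a collection of codes of pairs. -/
def prod (A B : Set M) : Set M := {p | ∃ a ∈ A, ∃ b ∈ B, p = pair a b}

/-- `F` is (the graph of) a function from `A` to `B`. -/
def IsFunction (F A B : Set M) : Prop :=
  F ⊆ prod A B ∧ ∀ a ∈ A, ∃! b, pair a b ∈ F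

/-- `e` has the form `(k, (m, n))`. -/
def IsTriple (e : M) : Prop := ∃ k m n : M, e = pair k (pair m n)

variable [LinearOrder M]

/-- The finite set coded by the triple `e = (k, (m, n))`: those `i < k` for which
`m * (i + 1) + 1` divides `n`. -/
def decode (e : M) : Set M :=
  {i | ∃ k m n : M, e = pair k (pair m n) ∧ i < k ∧ m * (i + 1) + 1 ∣ n}

/-- `e` is the code of a finite set, that is, the least triple that codes this set. -/
def IsFinsetCode (e : M) : Prop :=
  IsTriple e ∧ ∀ e' < e, IsTriple e' → decode e' ≠ decode e

/-- The collection of (codes of) finite subsets of `I`. -/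
def finSubsets (I : Set M) : Set M := {e | IsFinsetCode e ∧ decode e ⊆ I}

end Coding

/-! ## Countable second-countable spaces -/

/-- The data `(X, (U i) (i ∈ I), k)` of a countable second-countable space; the sequence `U` is
given by the set of the pairs `(x, i)` with `x ∈ U i`. -/
structure SpaceData (M : Type u) where
  /-- the set of points -/
  X : Set M
  /-- the index set of the base -/
  I : Set M
  /-- the sequence of basic open sets -/
  U : Set M
  /-- the graph of the function `k : X × I × I → I` -/
  k : Set M

section Spaces

variable {M : Type u} [CommSemiring M]

namespace SpaceData

/-- The basic open set with index `i`. -/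
def basic (D : SpaceData M) (i : M) : Set M := {x | pair x i ∈ D.U}

/-- The subspace on `Y ⊆ X`: the basic open sets are intersected with `Y`, and `k` is restricted
to `Y × I × I`. -/
def subspace (D : SpaceData M) (Y : Set M) : SpaceData M where
  X := Y
  I := D.I
  U := {p | p ∈ D.U ∧ ∃ x ∈ Y, ∃ i ∈ D.I, p = pair x i}
  k := {p | p ∈ D.k ∧ ∃ x ∈ Y, ∃ i ∈ D.I, ∃ j ∈ D.I, ∃ l ∈ D.I,
    p = pair (pair (pair x i) j) l}

end SpaceData

/-- `D` is a countable second-countable space in the sense of `(M, S)`. -/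
structure IsCSCSpace (S : Set (Set M)) (D : SpaceData M) : Prop where
  mem_X : D.X ∈ S
  mem_I : D.I ∈ S
  mem_U : D.U ∈ S
  mem_k : D.k ∈ S
  U_subset : D.U ⊆ prod D.X D.I
  k_function : IsFunction D.k (prod (prod D.X D.I) D.I) D.I
  cover : ∀ x ∈ D.X, ∃ i ∈ D.I, x ∈ D.basic i
  inter : ∀ x i j l : M, pair (pair (pair x i) j) l ∈ D.k →
    x ∈ D.basic i ∩ D.basic j →
    x ∈ D.basic l ∧ D.basic l ⊆ D.basic i ∩ D.basic j

variable [LinearOrder M]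

namespace SpaceData

/-- `h` is a function `ℕ → P_f(I)` of `(M, S)`: a code of an effectively open (or closed) set. -/
def IsCode (S : Set (Set M)) (D : SpaceData M) (h : Set M) : Prop :=
  h ∈ S ∧ IsFunction h Set.univ (finSubsets D.I)

/-- The effectively open set `G_h`, the union of the `U i` over all `n` and all `i ∈ h n`. It is a
definable collection of numbers, not necessarily a member of `S`. -/
def effOpen (D : SpaceData M) (h : Set M) : Set M :=
  {x | ∃ n e i : M, pair n e ∈ h ∧ i ∈ decode e ∧ x ∈ D.basic i}

/-- The union of the `U i` over all `n < N` and all `i ∈ h n`. -/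
def effOpenBelow (D : SpaceData M) (h : Set M) (N : M) : Set M :=
  {x | ∃ n e i : M, n < N ∧ pair n e ∈ h ∧ i ∈ decode e ∧ x ∈ D.basic i}

/-- The effectively closed set `F_h`. -/
def effClosed (D : SpaceData M) (h : Set M) : Set M := D.X \ D.effOpen h

/-- `g` is a function `ℕ × ℕ → P_f(I)` of `(M, S)`: a code of a sequence of effectively open
(or closed) sets. -/
def IsSeqCode (S : Set (Set M)) (D : SpaceData M) (g : Set M) : Prop :=
  g ∈ S ∧ IsFunction g (prod Set.univ Set.univ) (finSubsets D.I)

/-- The space is compact, in the sense of `(M, S)`. -/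
def IsCompact (S : Set (Set M)) (D : SpaceData M) : Prop :=
  ∀ h, D.IsCode S h → D.X = D.effOpen h → ∃ N : M, D.X = D.effOpenBelow h N

/-- The effectively open set `G_h` is compact, in the sense of `(M, S)`. -/
def IsCompactEffOpen (S : Set (Set M)) (D : SpaceData M) (h : Set M) : Prop :=
  ∀ f, D.IsCode S f → D.effOpen h ⊆ D.effOpen f →
    ∃ N : M, D.effOpen h ⊆ D.effOpenBelow f N

end SpaceData

/-- The function `g(n, ·)`, for a function `g` of two arguments. -/
def row (g : Set M) (n : M) : Set M :=
  {p | ∃ m e : M, p = pair m e ∧ pair (pair n m) e ∈ g}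

end Spaces

end RevMath

/-! All conditions reduce to (ii): the enumeration of `G_h` by stages stops. (i) ↔ (ii) is
immediate, (ii) ↔ (iv) repackages codes, and (v) is (iv) for complements.

The substance is (iii) → (ii). `G_h` is only Σ⁰₁, so it need not be a subspace to which compactness
applies; but each set `Y ⊆ G_h` lies in one stage. `exists_stage_of_subsets` concludes from this
alone. The set of `x` enumerated by stage `x` lies in some stage `c`, so any point of `G_h` outside
stage `c` appears only after its own value. If such points are unbounded, `exists_unbounded_subset`
gives an unbounded set of them, which fits in no stage. If they are bounded,
`bounded_sigma_comprehension` collects the part of `G_h` below the bound, and its union with stage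
`c` is a set equal to `G_h`. -/

namespace RevMath

universe u

/-! ## Definability by bounded formulas -/

section Definability

variable {M : Type u}

/-- `c` occurs in the sequence `w`. -/
class Listed {α : Type u} (w : ℕ → α) (c : α) : Prop where
  out : ∃ i, w i = c

instance Listed.head {α : Type u} (c : α) (w : ℕ → α) : Listed (push c w) c := ⟨0, rfl⟩

instance Listed.tail {α : Type u} (c d : α) (w : ℕ → α) [h : Listed w c] :
    Listed (push d w) c :=
  let ⟨i, hi⟩ := h.out
  ⟨i + 1, hi⟩

theorem push_mem {α : Type u} {S : Set α} {a : α} {w : ℕ → α} (ha : a ∈ S) (hw : ∀ i, w i ∈ S) :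
    ∀ i, push a w i ∈ S
  | 0 => ha
  | i + 1 => hw i

variable [CommSemiring M]

/-- The term `t` with the variables shifted by one. -/
def Term.shift : Term → Term
  | .var n => .var (n + 1)
  | .zero => .zero
  | .one => .one
  | .add t s => .add t.shift s.shift
  | .mul t s => .mul t.shift s.shift

theorem Term.eval_shift (v : ℕ → M) (t : Term) : t.shift.eval v = t.eval fun i => v (i + 1) := by
  induction t <;> simp_all [Term.shift, Term.eval]

/-- `t` is given by a term, on the assignments which agree with the parameters `w` from the
variable `k` on. -/
class TermDef (w : ℕ → M) (k : ℕ) (t : (ℕ → M) → M) : Prop where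
  out : ∃ s : Term, ∀ v, (∀ i, v (i + k) = w i) → s.eval v = t v

/-- `P` is given by a bounded formula with set parameters `A`, on the assignments which agree
with the parameters `w` from the variable `k` on. -/
class BddDef [LinearOrder M] (A : ℕ → Set M) (w : ℕ → M) (k : ℕ) (P : (ℕ → M) → Prop) : Prop where
  out : ∃ θ : BddFormula, ∀ v, (∀ i, v (i + k) = w i) → (θ.Realize A v ↔ P v)

variable {A : ℕ → Set M} {w : ℕ → M} {k : ℕ} {s t : (ℕ → M) → M} {P Q : (ℕ → M) → Prop}

/-- These instances let type class search build the bounded formula from the shape of a predicate;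
`k` counts the variables in front of the parameters. -/
instance TermDef.var (i : ℕ) : TermDef w k (fun v => v i) := ⟨.var i, fun _ _ => rfl⟩

instance TermDef.zero : TermDef w k (fun _ => 0) := ⟨.zero, fun _ _ => rfl⟩

instance TermDef.one : TermDef w k (fun _ => 1) := ⟨.one, fun _ _ => rfl⟩

instance TermDef.const (c : M) [h : Listed w c] : TermDef w k (fun _ => c) :=
  let ⟨i, hi⟩ := h.out
  ⟨.var (i + k), fun _ hv => (hv i).trans hi⟩

instance TermDef.add [hs : TermDef w k s] [ht : TermDef w k t] :
    TermDef w k (fun v => s v + t v) :=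
  let ⟨a, ha⟩ := hs.out
  let ⟨b, hb⟩ := ht.out
  ⟨.add a b, fun v hv => congrArg₂ (· + ·) (ha v hv) (hb v hv)⟩

instance TermDef.mul [hs : TermDef w k s] [ht : TermDef w k t] :
    TermDef w k (fun v => s v * t v) :=
  let ⟨a, ha⟩ := hs.out
  let ⟨b, hb⟩ := ht.out
  ⟨.mul a b, fun v hv => congrArg₂ (· * ·) (ha v hv) (hb v hv)⟩

theorem TermDef.shift [ht : TermDef w k t] : TermDef w (k + 1) (fun u => t fun i => u (i + 1)) :=
  let ⟨a, ha⟩ := ht.out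
  ⟨a.shift, fun v hv => (a.eval_shift v).trans (ha _ hv)⟩

instance TermDef.pair [TermDef w k s] [TermDef w k t] :
    TermDef w k (fun v => pair (s v) (t v)) := by
  simp only [RevMath.pair, sq]
  infer_instance

variable [LinearOrder M]

theorem BddDef.congr (h : BddDef A w k P) (hPQ : ∀ v, P v ↔ Q v) : BddDef A w k Q :=
  (funext fun v => propext (hPQ v) : P = Q) ▸ h

instance BddDef.eq [hs : TermDef w k s] [ht : TermDef w k t] :
    BddDef A w k (fun v => s v = t v) :=
  let ⟨a, ha⟩ := hs.out
  let ⟨b, hb⟩ := ht.out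
  ⟨.eq a b, fun v hv => by rw [BddFormula.Realize, ha v hv, hb v hv]⟩

instance BddDef.lt [hs : TermDef w k s] [ht : TermDef w k t] :
    BddDef A w k (fun v => s v < t v) :=
  let ⟨a, ha⟩ := hs.out
  let ⟨b, hb⟩ := ht.out
  ⟨.lt a b, fun v hv => by rw [BddFormula.Realize, ha v hv, hb v hv]⟩

instance BddDef.mem (B : Set M) [hB : Listed A B] [ht : TermDef w k t] :
    BddDef A w k (fun v => t v ∈ B) :=
  let ⟨a, ha⟩ := ht.out
  let ⟨i, hi⟩ := hB.out
  ⟨.mem a i, fun v hv => by rw [BddFormula.Realize, ha v hv, hi]⟩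

instance BddDef.not [hP : BddDef A w k P] : BddDef A w k (fun v => ¬ P v) :=
  let ⟨θ, hθ⟩ := hP.out
  ⟨.neg θ, fun v hv => not_congr (hθ v hv)⟩

instance BddDef.and [hP : BddDef A w k P] [hQ : BddDef A w k Q] :
    BddDef A w k (fun v => P v ∧ Q v) :=
  let ⟨θ, hθ⟩ := hP.out
  let ⟨η, hη⟩ := hQ.out
  ⟨.and θ η, fun v hv => and_congr (hθ v hv) (hη v hv)⟩

instance BddDef.or [hP : BddDef A w k P] [hQ : BddDef A w k Q] :
    BddDef A w k (fun v => P v ∨ Q v) :=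
  (inferInstance : BddDef A w k (fun v => ¬ (¬ P v ∧ ¬ Q v))).congr fun _ => by tauto

instance BddDef.imp [hP : BddDef A w k P] [hQ : BddDef A w k Q] :
    BddDef A w k (fun v => P v → Q v) :=
  (inferInstance : BddDef A w k (fun v => ¬ (P v ∧ ¬ Q v))).congr fun _ => by tauto

instance BddDef.le [hs : TermDef w k s] [ht : TermDef w k t] :
    BddDef A w k (fun v => s v ≤ t v) :=
  (inferInstance : BddDef A w k (fun v => ¬ (t v < s v))).congr fun _ => not_lt

instance BddDef.exists_lt {Q : M → (ℕ → M) → Prop} [ht : TermDef w k t]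
    [hQ : BddDef A w (k + 1) (fun u => Q (u 0) (fun i => u (i + 1)))] :
    BddDef A w k (fun v => ∃ x, x < t v ∧ Q x v) :=
  let ⟨a, ha⟩ := ht.out
  let ⟨θ, hθ⟩ := hQ.out
  ⟨.bex a θ, fun v hv => by
    rw [BddFormula.Realize, ha v hv]
    exact exists_congr fun x => and_congr_right fun _ => hθ (push x v) hv⟩

instance BddDef.forall_lt {Q : M → (ℕ → M) → Prop} [ht : TermDef w k t]
    [hQ : BddDef A w (k + 1) (fun u => Q (u 0) (fun i => u (i + 1)))] :
    BddDef A w k (fun v => ∀ x, x < t v → Q x v) :=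
  (inferInstance : BddDef A w k (fun v => ¬ ∃ x, x < t v ∧ ¬ Q x v)).congr fun _ => by
    push Not; rfl

variable [IsStrictOrderedRing M] {S : Set (Set M)}

/-- Induction for `Σ⁰₁` predicates. -/
theorem IsModelRCA0.sigma_induction (hM : IsModelRCA0 M S) {A : ℕ → Set M} (w : ℕ → M)
    (hA : ∀ i, A i ∈ S) (R : M → M → Prop) [hR : BddDef A w 2 (fun u => R (u 0) (u 1))]
    (h0 : ∃ m, R m 0) (hs : ∀ n, (∃ m, R m n) → ∃ m, R m (n + 1)) (n : M) : ∃ m, R m n := by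
  obtain ⟨θ, hθ⟩ := hR.out
  have key (n : M) : SigmaOne θ A w n ↔ ∃ m, R m n :=
    exists_congr fun m => hθ (push m (push n w)) fun _ => rfl
  simp only [← key] at h0 hs ⊢
  exact hM.induction θ A w hA h0 hs n

/-- Comprehension for `Δ⁰₁` predicates. -/
theorem IsModelRCA0.delta_comprehension (hM : IsModelRCA0 M S) {A : ℕ → Set M} (w : ℕ → M)
    (hA : ∀ i, A i ∈ S) (R T : M → M → Prop) [hR : BddDef A w 2 (fun u => R (u 0) (u 1))]
    [hT : BddDef A w 2 (fun u => T (u 0) (u 1))]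
    (h : ∀ n, (∃ m, R m n) ↔ ∀ m, T m n) : {n | ∃ m, R m n} ∈ S := by
  obtain ⟨θ, hθ⟩ := hR.out
  obtain ⟨η, hη⟩ := hT.out
  have key (n : M) : SigmaOne θ A w n ↔ ∃ m, R m n :=
    exists_congr fun m => hθ (push m (push n w)) fun _ => rfl
  have key' (n : M) : PiOne η A w n ↔ ∀ m, T m n :=
    forall_congr' fun m => hη (push m (push n w)) fun _ => rfl
  simp only [← key, ← key'] at h ⊢
  exact hM.comprehension θ η A w hA h

/-- Comprehension for bounded predicates. -/
theorem IsModelRCA0.bdd_comprehension (hM : IsModelRCA0 M S) {A : ℕ → Set M} (w : ℕ → M)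
    (hA : ∀ i, A i ∈ S) (R : M → Prop) [hR : BddDef A w 2 (fun u => R (u 1))] :
    {n | R n} ∈ S := by
  simpa using hM.delta_comprehension w hA (fun _ n => R n) (fun _ n => R n) (by simp)

/-- Induction for bounded predicates. -/
theorem IsModelRCA0.bdd_induction (hM : IsModelRCA0 M S) {A : ℕ → Set M} (w : ℕ → M)
    (hA : ∀ i, A i ∈ S) (R : M → Prop) [hR : BddDef A w 2 (fun u => R (u 1))]
    (h0 : R 0) (hs : ∀ n, R n → R (n + 1)) (n : M) : R n := by
  simpa using hM.sigma_induction w hA (fun _ n => R n) (by simpa using h0) (by simpa using hs) n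

end Definability

/-! ## Arithmetic -/

section Arithmetic

variable (M : Type u) [CommSemiring M] [LinearOrder M]

/-- The order is discrete, and it is the natural order of the addition. -/
class IsDiscrete : Prop extends CanonicallyOrderedAdd M where
  one_le : ∀ a : M, 0 < a → 1 ≤ a

variable {M} [IsStrictOrderedRing M] {S : Set (Set M)}

/-- The semiring axioms give neither nonnegativity nor subtraction; both come from induction. -/
theorem IsModelRCA0.isDiscrete (hM : IsModelRCA0 M S) : IsDiscrete M := by
  obtain ⟨B, hB⟩ := hM.nonempty
  have hA : ∀ _ : ℕ, B ∈ S := fun _ => hB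
  have nonneg (a : M) : 0 ≤ a :=
    hM.bdd_induction (fun _ => 0) hA (fun n => 0 ≤ n) le_rfl
      (fun n hn => hn.trans (le_add_of_nonneg_right zero_le_one)) a
  have pred (a : M) : a = 0 ∨ ∃ m, m < a ∧ a = m + 1 :=
    hM.bdd_induction (fun _ => 0) hA (fun n => n = 0 ∨ ∃ m, m < n ∧ n = m + 1) (.inl rfl)
      (fun n _ => .inr ⟨n, lt_add_one n, rfl⟩) a
  have succ_le (a n : M) (h : n < a) : n + 1 ≤ a := by
    refine hM.bdd_induction (push (n + 1) fun _ => 0) hA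
      (fun a => ∀ i, i < n + 1 → i < a → i + 1 ≤ a) ?_ ?_ a n (lt_add_one n) h
    · exact fun i _ hi => absurd hi (nonneg i).not_gt
    · intro a ih i hin hia
      rcases pred i with rfl | ⟨m, -, rfl⟩
      · simpa using nonneg a
      · exact add_le_add_left (ih m ((lt_add_one m).trans hin) (lt_of_add_lt_add_right hia)) 1
  -- The alternative `n < a` lets the induction start at `0`.
  have sub (a b : M) (hab : a ≤ b) : ∃ c, b = a + c := by
    have := hM.sigma_induction (push a fun _ => 0) hA (fun m n => n = a + m ∨ n < a)
      (by
        rcases (nonneg a).eq_or_lt with h | h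
        · exact ⟨0, .inl (by rw [← h, add_zero])⟩
        · exact ⟨0, .inr h⟩)
      (by
        rintro n ⟨m, rfl | h⟩
        · exact ⟨m + 1, .inl (add_assoc _ _ _)⟩
        · rcases (succ_le a n h).eq_or_lt with h | h
          · exact ⟨0, .inl (by rw [h, add_zero])⟩
          · exact ⟨0, .inr h⟩) b
    exact this.imp fun c hc => hc.resolve_right hab.not_gt
  exact
    { exists_add_of_le := fun {a b} h => sub a b h
      le_add_self := fun a b => le_add_of_nonneg_left (nonneg b)
      le_self_add := fun a b => le_add_of_nonneg_right (nonneg b)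
      one_le := hM.discrete }

end Arithmetic

/-! ### Pairing, coded finite sets, least numbers and bounded comprehension -/

section Coding

variable {M : Type u} [CommSemiring M]

theorem pair_zero_zero : pair (0 : M) 0 = 0 := by simp [pair]

variable [LinearOrder M]

theorem pos_of_ne_zero [IsDiscrete M] {a : M} (h : a ≠ 0) : 0 < a := lt_of_le_of_ne zero_le h.symm

theorem le_pair_left [IsDiscrete M] (a b : M) : a ≤ pair a b := le_add_self

theorem exists_eq_add_one [IsDiscrete M] {a : M} (h : a ≠ 0) : ∃ b, a = b + 1 :=
  (exists_add_of_le (IsDiscrete.one_le a (pos_of_ne_zero h))).imp fun _ hb => hb.trans (add_comm _ _)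

theorem lt_of_mem_decode [IsDiscrete M] {i e : M} (h : i ∈ decode e) : i < e := by
  obtain ⟨k, m, n, rfl, hi, -⟩ := h
  exact hi.trans_le (le_pair_left _ _)

theorem decode_zero [IsDiscrete M] : decode (0 : M) = ∅ :=
  Set.eq_empty_of_forall_notMem fun _ h => (lt_of_mem_decode h).not_ge zero_le

theorem zero_mem_finSubsets [IsDiscrete M] (I : Set M) : (0 : M) ∈ finSubsets I :=
  ⟨⟨⟨0, 0, 0, by simp [pair_zero_zero]⟩, fun _ h => absurd h zero_le.not_gt⟩,
    by simp [decode_zero]⟩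

variable [IsStrictOrderedRing M] {S : Set (Set M)}

section

variable [IsDiscrete M]

theorem add_one_le {a b : M} (h : a < b) : a + 1 ≤ b := by
  obtain ⟨c, rfl⟩ := exists_add_of_le h.le
  exact add_le_add_right (IsDiscrete.one_le c ((lt_add_iff_pos_right a).1 h)) a

theorem le_of_lt_add_one {a b : M} (h : a < b + 1) : a ≤ b :=
  not_lt.1 fun h' => (add_one_le h').not_gt h

theorem le_mul_of_ne_zero {a b : M} (h : a ≠ 0) : b ≤ a * b :=
  le_mul_of_one_le_left zero_le (IsDiscrete.one_le a (pos_of_ne_zero h))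

/-- In place of subtraction, the two quotients are compared; if the second is not larger, then `c =
0`. -/
theorem dvd_of_dvd_add {a b c : M} (h : a ∣ b + c) (hb : a ∣ b) : a ∣ c := by
  obtain ⟨u, rfl⟩ := hb
  obtain ⟨v, hv⟩ := h
  rcases le_total u v with huv | huv
  · obtain ⟨w, rfl⟩ := exists_add_of_le huv
    exact ⟨w, add_left_cancel (hv.trans (mul_add a u w))⟩
  · obtain ⟨w, rfl⟩ := exists_add_of_le huv
    have : a * v + (a * w + c) = a * v + 0 := by
      rw [add_zero, ← add_assoc, ← mul_add, hv]
    have := add_left_cancel this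
    exact ⟨0, by rw [mul_zero]; exact (add_eq_zero.1 this).2⟩

/-- The code of `(a, b)` lies in the interval from `(a + b) ^ 2` to `(a + b + 1) ^ 2`, so it
determines `a + b`. -/
theorem pair_lt_pair {a b c d : M} (h : a + b < c + d) : pair a b < pair c d := by
  obtain ⟨e, he⟩ := exists_add_of_le (add_one_le h)
  calc pair a b < (a + b + 1) ^ 2 := by
        obtain ⟨f, hf⟩ : ∃ f, (a + b + 1) ^ 2 = pair a b + (f + 1) :=
          ⟨a + b + b, by rw [pair]; ring⟩
        rw [hf]
        exact lt_add_of_pos_right _ (add_pos_of_nonneg_of_pos zero_le one_pos)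
    _ ≤ (c + d) ^ 2 := by rw [he]; exact pow_le_pow_left₀ zero_le le_self_add 2
    _ ≤ pair c d := le_self_add

theorem pair_inj {a b c d : M} : pair a b = pair c d ↔ a = c ∧ b = d := by
  refine ⟨fun h => ?_, by rintro ⟨rfl, rfl⟩; rfl⟩
  have h1 : a + b = c + d := le_antisymm (not_lt.1 fun h' => (pair_lt_pair h').ne h.symm)
    (not_lt.1 fun h' => (pair_lt_pair h').ne h)
  have h2 : a = c := by
    rw [pair, pair, h1] at h
    exact add_left_cancel h
  exact ⟨h2, by rw [h2] at h1; exact add_left_cancel h1⟩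

theorem le_pair_right (a b : M) : b ≤ pair a b := by
  rcases eq_or_ne b 0 with rfl | h
  · exact zero_le
  · rw [pair, sq]
    exact (le_add_self.trans (le_mul_of_ne_zero (by simp [h]))).trans le_self_add

variable {A : ℕ → Set M} {w : ℕ → M} {k : ℕ} {s t : (ℕ → M) → M}

instance BddDef.dvd [TermDef w k s] [TermDef w k t] : BddDef A w k (fun v => s v ∣ t v) :=
  have : TermDef w (k + 1) (fun u => s fun i => u (i + 1)) := .shift
  have : TermDef w (k + 1) (fun u => t fun i => u (i + 1)) := .shift
  (inferInstance : BddDef A w k (fun v => ∃ q, q < t v + 1 ∧ t v = s v * q)).congr fun v => by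
    refine ⟨fun ⟨q, _, hq⟩ => ⟨q, hq⟩, fun ⟨q, hq⟩ => ?_⟩
    rcases eq_or_ne (s v) 0 with h | h
    · exact ⟨0, by simp [add_pos_of_nonneg_of_pos (zero_le (a := t v))], by rw [hq, h]; simp⟩
    · exact ⟨q, (hq ▸ le_mul_of_ne_zero h).trans_lt (lt_add_one _), hq⟩

instance BddDef.mem_decode [TermDef w k s] [TermDef w k t] :
    BddDef A w k (fun v => s v ∈ decode (t v)) :=
  have : TermDef w (k + 1) (fun u => t fun i => u (i + 1)) := .shift
  have : TermDef w (k + 2) (fun u => t fun i => u (i + 2)) := .shift (t := fun u => t fun i => u (i + 1))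
  have : TermDef w (k + 3) (fun u => t fun i => u (i + 3)) :=
    .shift (t := fun u => t fun i => u (i + 2))
  have : TermDef w (k + 1) (fun u => s fun i => u (i + 1)) := .shift
  have : TermDef w (k + 2) (fun u => s fun i => u (i + 2)) := .shift (t := fun u => s fun i => u (i + 1))
  have : TermDef w (k + 3) (fun u => s fun i => u (i + 3)) :=
    .shift (t := fun u => s fun i => u (i + 2))
  (inferInstance : BddDef A w k (fun v => ∃ k, k < t v + 1 ∧ ∃ m, m < t v + 1 ∧ ∃ n, n < t v + 1 ∧
    t v = pair k (pair m n) ∧ s v < k ∧ m * (s v + 1) + 1 ∣ n)).congr fun v => by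
    constructor
    · rintro ⟨k, -, m, -, n, -, h⟩
      exact ⟨k, m, n, h⟩
    · rintro ⟨k, m, n, h, h'⟩
      have hlt {x : M} (hx : x ≤ pair k (pair m n)) : x < t v + 1 :=
        (hx.trans_eq h.symm).trans_lt (lt_add_one _)
      exact ⟨k, hlt (le_pair_left _ _), m, hlt ((le_pair_left _ _).trans (le_pair_right _ _)),
        n, hlt ((le_pair_right _ _).trans (le_pair_right _ _)), h, h'⟩

/-- The moduli of the coding of finite sets are coprime. -/
theorem dvd_of_dvd_mul_modulus {m b i j n : M} (hm : ∀ i < b, i + 1 ∣ m) (hi : i < b) (hj : j < b)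
    (hij : i ≠ j) (h : m * (j + 1) + 1 ∣ (m * (i + 1) + 1) * n) : m * (j + 1) + 1 ∣ n := by
  -- With `p i = m * (i + 1) + 1`, the difference of `(j + 1) * p i` and `(i + 1) * p j` is `j - i`
  -- up to sign; `d + 1` is `|j - i|`.
  obtain ⟨d, hd, h1⟩ : ∃ d, d + 1 ∣ m ∧ m * (j + 1) + 1 ∣ (d + 1) * n := by
    have sub_one_lt {x d : M} (hx : x + (d + 1) < b) : d < b :=
      (lt_add_one d).trans (le_add_self.trans_lt hx)
    rcases hij.lt_or_gt with hij | hij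
    · obtain ⟨c, rfl⟩ := exists_add_of_le hij.le
      obtain ⟨d, rfl⟩ := exists_eq_add_one (a := c) (by rintro rfl; simp at hij)
      refine ⟨d, hm d (sub_one_lt hj), dvd_of_dvd_add (b := (i + 1) * n * (m * (i + (d + 1) + 1) + 1))
        ?_ (Dvd.intro_left _ rfl)⟩
      refine (h.mul_left (i + (d + 1) + 1)).trans (dvd_of_eq ?_)
      ring
    · obtain ⟨c, rfl⟩ := exists_add_of_le hij.le
      obtain ⟨d, rfl⟩ := exists_eq_add_one (a := c) (by rintro rfl; simp at hij)
      refine ⟨d, hm d (sub_one_lt hi), dvd_of_dvd_add (b := (j + 1) * ((m * (j + (d + 1) + 1) + 1) * n))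
        ?_ (h.mul_left _)⟩
      refine (Dvd.intro_left ((j + (d + 1) + 1) * n) rfl).trans (dvd_of_eq ?_)
      ring
  -- As `d + 1` divides `m`, the modulus divides `m * (j + 1) * n`, and also that number plus `n`.
  obtain ⟨q, rfl⟩ := hd
  refine dvd_of_dvd_add (b := q * (j + 1) * ((d + 1) * n)) ?_ (h1.mul_left _)
  exact (Dvd.intro_left n rfl).trans (dvd_of_eq (by ring))

end

/-- Σ⁰₁ induction multiplies in one factor at a time. The `3` counts the variables `i`, `m`, `b` of
the induction formula. -/
theorem IsModelRCA0.exists_common_multiple (hM : IsModelRCA0 M S) {A : ℕ → Set M} (w : ℕ → M)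
    (hA : ∀ i, A i ∈ S) (f : M → M) (hf : ∀ i, f i ≠ 0) [hR : TermDef w 3 (fun u => f (u 0))]
    [IsDiscrete M] (b : M) : ∃ m, m ≠ 0 ∧ ∀ i < b, f i ∣ m := by
  refine hM.sigma_induction w hA (fun m b => ¬ m = 0 ∧ ∀ i < b, f i ∣ m) ?_ ?_ b
  · exact ⟨1, one_ne_zero, fun i hi => absurd hi zero_le.not_gt⟩
  · rintro n ⟨m, hm, h⟩
    have : NoZeroDivisors M := inferInstance
    refine ⟨m * f n, mul_ne_zero hm (hf n), fun i hi => ?_⟩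
    rcases (le_of_lt_add_one hi).eq_or_lt with rfl | hi
    · exact Dvd.intro_left _ rfl
    · exact (h i hi).mul_right _

/-- The least number principle for `Π⁰₁` predicates. -/
theorem IsModelRCA0.exists_least_pi (hM : IsModelRCA0 M S) {A : ℕ → Set M} (w : ℕ → M)
    (hA : ∀ i, A i ∈ S) (R : M → M → Prop) [hR : BddDef A w 4 (fun u => R (u 0) (u 1))]
    {a : M} (ha : ∀ m, R m a) : ∃ n, (∀ m, R m n) ∧ ∀ n' < n, ∃ m, ¬ R m n' := by
  have := hM.isDiscrete
  by_contra! hno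
  -- Without a least element, counterexamples propagate upwards; one bound `W` for all of them below
  -- `n` keeps the statement Σ⁰₁.
  have key (n : M) : ∃ W, ∀ y, y < n → ∃ m, m < W ∧ ¬ R m y := by
    refine hM.sigma_induction w hA (fun W n => ∀ y, y < n → ∃ m, m < W ∧ ¬ R m y) ?_ ?_ n
    · exact ⟨0, fun y hy => absurd hy zero_le.not_gt⟩
    · rintro n ⟨W, hW⟩
      obtain ⟨m, hm⟩ : ∃ m, ¬ R m n := by
        by_contra! h
        obtain ⟨n', hn', h'⟩ := hno n h
        obtain ⟨m, -, hm⟩ := hW n' hn'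
        exact hm (h' m)
      refine ⟨W + (m + 1), fun y hy => ?_⟩
      rcases (le_of_lt_add_one hy).eq_or_lt with rfl | hy
      · exact ⟨m, (lt_add_one m).trans_le le_add_self, hm⟩
      · obtain ⟨m', h1, h2⟩ := hW y hy
        exact ⟨m', h1.trans_le le_self_add, h2⟩
  obtain ⟨W, hW⟩ := key (a + 1)
  obtain ⟨m, -, hm⟩ := hW a (lt_add_one a)
  exact hm (ha m)

/-- The least number principle for bounded predicates. -/
theorem IsModelRCA0.exists_least (hM : IsModelRCA0 M S) {A : ℕ → Set M} (w : ℕ → M)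
    (hA : ∀ i, A i ∈ S) (R : M → Prop) [hR : BddDef A w 4 (fun u => R (u 1))]
    {a : M} (ha : R a) : ∃ n, R n ∧ ∀ n' < n, ¬ R n' := by
  simpa using hM.exists_least_pi w hA (fun _ n => R n) (fun _ => ha)

/-- Bounded `Σ⁰₁` comprehension, for the projection of a set. -/
theorem IsModelRCA0.bounded_sigma_comprehension (hM : IsModelRCA0 M S) {V : Set M} (hV : V ∈ S)
    (b : M) : {x | x < b ∧ ∃ n, pair n x ∈ V} ∈ S := by
  have := hM.isDiscrete
  have hA : ∀ i, push V (fun _ => V) i ∈ S := push_mem hV fun _ => hV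
  obtain ⟨m, hm0, hm⟩ := hM.exists_common_multiple (fun _ => 0) hA (fun i => i + 1)
    (fun i => by simp) b
  obtain ⟨a, ha0, ha⟩ := hM.exists_common_multiple (push m fun _ => 0) hA
    (fun i => m * (i + 1) + 1) (fun i => by simp) b
  -- The code is the least nonzero common multiple of the moduli of the members; being such a
  -- multiple is Π⁰₁.
  obtain ⟨n, hn, hmin⟩ := hM.exists_least_pi (push m (push b fun _ => 0)) hA
    (fun r n => ¬ n = 0 ∧ ∀ x, x < b → pair r x ∈ V → m * (x + 1) + 1 ∣ n) (a := a)
    (fun r => ⟨ha0, fun x hx _ => ha x hx⟩)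
  have key : {x | x < b ∧ ∃ n, pair n x ∈ V} = {x | x < b ∧ m * (x + 1) + 1 ∣ n} := by
    ext x
    refine and_congr_right fun hx => ⟨fun ⟨r, hr⟩ => (hn r).2 x hx hr, ?_⟩
    rintro ⟨q, rfl⟩
    by_contra! hxV
    have hq0 : q ≠ 0 := fun h => (hn 0).1 (by rw [h, mul_zero])
    -- If the modulus of a nonmember divided `n`, the smaller quotient `q` would still be a common
    -- multiple, by coprimality.
    have hlt : q < (m * (x + 1) + 1) * q :=
      lt_mul_of_one_lt_left (pos_of_ne_zero hq0)
        (lt_add_of_pos_left 1 (pos_of_ne_zero (by simp [hm0])))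
    obtain ⟨r, hr⟩ := hmin q hlt
    refine hr ⟨hq0, fun y hy hyV => ?_⟩
    exact dvd_of_dvd_mul_modulus hm hx hy (by rintro rfl; exact hxV r hyV) ((hn r).2 y hy hyV)
  rw [key]
  exact hM.bdd_comprehension (push b (push m (push n fun _ => 0))) hA
    (fun x => x < b ∧ m * (x + 1) + 1 ∣ n)

end Coding

/-! ### Exhausting a Σ⁰₁ class, and the implications between the conditions -/

section Compactness

variable {M : Type u} [CommSemiring M] [LinearOrder M]

theorem SpaceData.effOpenBelow_subset (D : SpaceData M) (h : Set M) (N : M) :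
    D.effOpenBelow h N ⊆ D.effOpen h :=
  fun _ ⟨n, e, i, _, hx⟩ => ⟨n, e, i, hx⟩

theorem SpaceData.effOpenBelow_mono (D : SpaceData M) (h : Set M) {N N' : M} (hN : N ≤ N') :
    D.effOpenBelow h N ⊆ D.effOpenBelow h N' :=
  fun _ ⟨n, e, i, hn, hx⟩ => ⟨n, e, i, hn.trans_le hN, hx⟩

variable [IsStrictOrderedRing M] {S : Set (Set M)}

/-- If a `Σ⁰₁` class, enumerated in the stages `{x | pair n x ∈ W}`, has members without bound that
are enumerated later than their own value, then it has an unbounded subset in `S`. -/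
theorem IsModelRCA0.exists_unbounded_subset (hM : IsModelRCA0 M S) {W : Set M} (hW : W ∈ S) {c : M}
    (hdiag : ∀ n x, pair n x ∈ W → pair c x ∉ W → x < n)
    (hunb : ∀ b, ∃ x ≥ b, (∃ n, pair n x ∈ W) ∧ pair c x ∉ W) :
    ∃ Y ∈ S, (∀ x ∈ Y, (∃ n, pair n x ∈ W) ∧ pair c x ∉ W) ∧ ∀ b, ∃ x ∈ Y, b ≤ x := by
  have := hM.isDiscrete
  have hA : ∀ i, push W (fun _ => W) i ∈ S := push_mem hW fun _ => hW
  -- `x` is kept if, when it appears, no larger `y < n` outside stage `c` has appeared before. For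
  -- the Π⁰₁ form: once some `y ≥ x` outside stage `c` appears at stage `m`, the fate of `x` is
  -- settled by `m`.
  refine ⟨_, hM.delta_comprehension (push c fun _ => 0) hA
    (fun n x => pair n x ∈ W ∧ pair c x ∉ W ∧ ∀ y < n, x < y → ∀ m < n, pair m y ∈ W → pair c y ∈ W)
    (fun m x => ∀ y < m, x ≤ y → pair m y ∈ W → ¬ pair c y ∈ W →
      ∃ n < m + 1, pair n x ∈ W ∧ pair c x ∉ W ∧
        ∀ y < n, x < y → ∀ m < n, pair m y ∈ W → pair c y ∈ W) ?_, ?_, ?_⟩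
  · refine fun x => ⟨?_, fun h => ?_⟩
    · rintro ⟨n, hn, hc, hT⟩ m y hym hxy hy hyc
      rcases le_or_gt n m with hnm | hmn
      · exact ⟨n, hnm.trans_lt (lt_add_one m), hn, hc, hT⟩
      · rcases hxy.eq_or_lt with rfl | hxy
        · exact ⟨m, lt_add_one m, hy, hc, fun y hy hxy k hk => hT y (hy.trans hmn) hxy k (hk.trans hmn)⟩
        · exact absurd (hT y (hym.trans hmn) hxy m hmn hy) hyc
    · obtain ⟨y, hxy, ⟨m, hm⟩, hyc⟩ := hunb x
      obtain ⟨n, -, hn⟩ := h m y (hdiag m y hm hyc) hxy hm hyc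
      exact ⟨n, hn⟩
  · rintro x ⟨n, hn, hc, -⟩
    exact ⟨⟨n, hn⟩, hc⟩
  · intro b
    obtain ⟨x, hbx, ⟨n, hn⟩, hc⟩ := hunb b
    -- The earliest stage showing a point `≥ b` outside stage `c` yields a kept point.
    obtain ⟨n, ⟨x, hxn, hbx, hn, hc⟩, hmin⟩ := hM.exists_least (push b (push c fun _ => 0)) hA
      (fun n => ∃ x < n, b ≤ x ∧ pair n x ∈ W ∧ pair c x ∉ W) (a := n)
      ⟨x, hdiag n x hn hc, hbx, hn, hc⟩
    refine ⟨x, ⟨n, hn, hc, fun y _ hxy m hm hy => ?_⟩, hbx⟩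
    by_contra hyc
    exact hmin m hm ⟨y, hdiag m y hy hyc, hbx.trans hxy.le, hy, hyc⟩

/-- A `Σ⁰₁` class is exhausted at some stage of its enumeration if each of its subsets in `S` is. -/
theorem IsModelRCA0.exists_stage_of_subsets (hM : IsModelRCA0 M S) {W : Set M} (hW : W ∈ S)
    (hmono : ∀ n m x, n ≤ m → pair n x ∈ W → pair m x ∈ W)
    (hY : ∀ Y ∈ S, (∀ x ∈ Y, ∃ n, pair n x ∈ W) → ∃ N, ∀ x ∈ Y, pair N x ∈ W) :
    ∃ N, ∀ n x, pair n x ∈ W → pair N x ∈ W := by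
  have := hM.isDiscrete
  have hA : ∀ i, push W (fun _ => W) i ∈ S := push_mem hW fun _ => hW
  obtain ⟨c, hc⟩ := hY _ (hM.bdd_comprehension (fun _ => 0) hA (fun x => pair x x ∈ W))
    fun x hx => ⟨x, hx⟩
  have hdiag (n x : M) (hn : pair n x ∈ W) (hx : pair c x ∉ W) : x < n :=
    not_le.1 fun h => hx (hc x (hmono n x x h hn))
  by_cases hunb : ∀ b, ∃ x ≥ b, (∃ n, pair n x ∈ W) ∧ pair c x ∉ W
  · obtain ⟨Y, hYS, hYW, hYunb⟩ := hM.exists_unbounded_subset hW hdiag hunb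
    obtain ⟨N, hN⟩ := hY Y hYS fun x hx => (hYW x hx).1
    obtain ⟨x, hx, hNx⟩ := hYunb N
    exact absurd (hdiag N x (hN x hx) (hYW x hx).2) hNx.not_gt
  · push Not at hunb
    obtain ⟨b, hb⟩ := hunb
    have hB := hM.bounded_sigma_comprehension hW b
    set B := {x | x < b ∧ ∃ n, pair n x ∈ W}
    obtain ⟨N, hN⟩ := hY _ (hM.bdd_comprehension (push c fun _ => 0) (push_mem hB hA)
        (fun x => x ∈ B ∨ pair c x ∈ W)) (by
      rintro x (hx | hx)
      exacts [hx.2, ⟨c, hx⟩])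
    refine ⟨N, fun n x hn => hN x ?_⟩
    rcases lt_or_ge x b with hx | hx
    · exact .inl ⟨hx, n, hn⟩
    · exact .inr (hb x hx ⟨n, hn⟩)

variable {D : SpaceData M} {h g Y : Set M}

namespace SpaceData

theorem mem_effOpen_iff [IsDiscrete M] {x : M} :
    x ∈ D.effOpen h ↔ ∃ n, x ∈ D.effOpenBelow h n :=
  ⟨fun ⟨n, e, i, hx⟩ => ⟨n + 1, n, e, i, lt_add_one n, hx⟩,
    fun ⟨n, hx⟩ => D.effOpenBelow_subset h n hx⟩

theorem effOpen_subset [IsDiscrete M] (hD : IsCSCSpace S D) (h : Set M) : D.effOpen h ⊆ D.X := by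
  rintro x ⟨n, e, i, -, -, hx⟩
  obtain ⟨a, ha, b, -, hab⟩ := hD.U_subset hx
  exact (pair_inj.1 hab).1 ▸ ha

theorem mem_subspace_basic [IsDiscrete M] (hD : IsCSCSpace S D) {x i : M} :
    x ∈ (D.subspace Y).basic i ↔ x ∈ Y ∧ x ∈ D.basic i := by
  constructor
  · rintro ⟨hx, y, hy, j, -, hxy⟩
    exact ⟨(pair_inj.1 hxy).1 ▸ hy, hx⟩
  · rintro ⟨hxY, hx⟩
    obtain ⟨a, -, b, hb, hab⟩ := hD.U_subset hx
    exact ⟨hx, x, hxY, i, (pair_inj.1 hab).2 ▸ hb, rfl⟩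

theorem effOpen_subspace [IsDiscrete M] (hD : IsCSCSpace S D) :
    (D.subspace Y).effOpen h = Y ∩ D.effOpen h := by
  ext x
  simp only [effOpen, mem_subspace_basic hD, Set.mem_ofPred_eq, Set.mem_inter_iff]
  tauto

theorem effOpenBelow_subspace [IsDiscrete M] (hD : IsCSCSpace S D) (N : M) :
    (D.subspace Y).effOpenBelow h N = Y ∩ D.effOpenBelow h N := by
  ext x
  simp only [effOpenBelow, mem_subspace_basic hD, Set.mem_ofPred_eq, Set.mem_inter_iff]
  tauto

/-- The stages of the enumeration of an effectively open set form a set of the model. -/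
theorem exists_stages (hM : IsModelRCA0 M S) (hD : IsCSCSpace S D) (hh : D.IsCode S h) :
    ∃ W ∈ S, ∀ n x, pair n x ∈ W ↔ x ∈ D.effOpenBelow h n := by
  have := hM.isDiscrete
  have hA : ∀ i, push h (push D.U fun _ => h) i ∈ S :=
    push_mem hh.1 (push_mem hD.mem_U fun _ => hh.1)
  -- As `h` is a function, its value `e` at `n` can be quantified either way, which makes `V` Δ⁰₁.
  have hV := hM.delta_comprehension (fun _ => 0) hA
    (fun e p => ∃ n < p + 1, ∃ x < p + 1, p = pair n x ∧ pair n e ∈ h ∧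
      ∃ i < e, i ∈ decode e ∧ pair x i ∈ D.U)
    (fun e p => ∃ n < p + 1, ∃ x < p + 1, p = pair n x ∧ (pair n e ∈ h →
      ∃ i < e, i ∈ decode e ∧ pair x i ∈ D.U)) (fun p => by
    constructor
    · rintro ⟨e, n, hn, x, hx, rfl, he, hi⟩ e'
      exact ⟨n, hn, x, hx, rfl, fun he' => (hh.2.2 n trivial).unique he he' ▸ hi⟩
    · intro H
      obtain ⟨n, hn, x, hx, rfl, -⟩ := H 0
      obtain ⟨e, he, -⟩ := hh.2.2 n trivial
      obtain ⟨n', -, x', -, hp, hi⟩ := H e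
      obtain ⟨rfl, rfl⟩ := pair_inj.1 hp
      exact ⟨e, n, hn, x, hx, rfl, he, hi he⟩)
  set V := {p | ∃ e, ∃ n < p + 1, ∃ x < p + 1, p = pair n x ∧ pair n e ∈ h ∧
      ∃ i < e, i ∈ decode e ∧ pair x i ∈ D.U}
  have mem_V (n x : M) : pair n x ∈ V ↔ ∃ e i, pair n e ∈ h ∧ i ∈ decode e ∧ x ∈ D.basic i := by
    constructor
    · rintro ⟨e, n', -, x', -, hp, he, i, -, hi, hx⟩
      obtain ⟨rfl, rfl⟩ := pair_inj.1 hp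
      exact ⟨e, i, he, hi, hx⟩
    · rintro ⟨e, i, he, hi, hx⟩
      exact ⟨e, n, (le_pair_left _ _).trans_lt (lt_add_one _), x,
        (le_pair_right _ _).trans_lt (lt_add_one _), rfl, he, i, lt_of_mem_decode hi, hi, hx⟩
  refine ⟨_, hM.bdd_comprehension (fun _ => 0) (push_mem hV hA)
    (fun p => ∃ n < p + 1, ∃ x < p + 1, p = pair n x ∧ ∃ m < n, pair m x ∈ V), fun n x => ?_⟩
  simp only [Set.mem_ofPred_eq, mem_V]
  constructor
  · rintro ⟨n', -, x', -, hp, m, hm, e, i, hx⟩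
    obtain ⟨rfl, rfl⟩ := pair_inj.1 hp
    exact ⟨m, e, i, hm, hx⟩
  · rintro ⟨m, e, i, hm, hx⟩
    exact ⟨n, (le_pair_left _ _).trans_lt (lt_add_one _), x,
      (le_pair_right _ _).trans_lt (lt_add_one _), rfl, m, hm, e, i, hx⟩

theorem exists_eq_effOpenBelow_of_subspaces (hM : IsModelRCA0 M S) (hD : IsCSCSpace S D)
    (hc : ∀ Y ∈ S, Y ⊆ D.X → (D.subspace Y).IsCompact S) (hh : D.IsCode S h) :
    ∃ N : M, D.effOpen h = D.effOpenBelow h N := by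
  have := hM.isDiscrete
  obtain ⟨W, hW, mem_W⟩ := exists_stages hM hD hh
  obtain ⟨N, hN⟩ := hM.exists_stage_of_subsets hW
    (fun n m x hnm => by simpa only [mem_W] using fun hx => D.effOpenBelow_mono h hnm hx)
    (fun Y hY hYW => by
      simp only [mem_W, ← mem_effOpen_iff] at hYW ⊢
      obtain ⟨N, hN⟩ := hc Y hY (Set.Subset.trans hYW (effOpen_subset hD h)) h hh
        ((effOpen_subspace hD).trans (Set.inter_eq_left.2 hYW)).symm
      exact ⟨N, fun x hx => ((effOpenBelow_subspace hD N).subset (hN.subset hx)).2⟩)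
  simp only [mem_W] at hN
  refine ⟨N, (effOpenBelow_subset D h N).antisymm' fun x hx => ?_⟩
  obtain ⟨n, hn⟩ := mem_effOpen_iff.1 hx
  exact hN n x hn

theorem isCompact_subspace [IsDiscrete M] (hD : IsCSCSpace S D)
    (hc : ∀ h, D.IsCode S h → ∃ N : M, D.effOpen h = D.effOpenBelow h N) (Y : Set M) :
    (D.subspace Y).IsCompact S := by
  intro h hh hY
  obtain ⟨N, hN⟩ := hc h hh
  exact ⟨N, by rw [effOpenBelow_subspace hD, ← hN, ← effOpen_subspace hD, ← hY]⟩

theorem mem_effOpen_row [IsDiscrete M] {n x : M} : x ∈ D.effOpen (row g n) ↔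
    ∃ m e i, pair (pair n m) e ∈ g ∧ i ∈ decode e ∧ x ∈ D.basic i := by
  constructor
  · rintro ⟨m, e, i, ⟨m', e', hp, hg⟩, hx⟩
    obtain ⟨rfl, rfl⟩ := pair_inj.1 hp
    exact ⟨m, e, i, hg, hx⟩
  · rintro ⟨m, e, i, hg, hx⟩
    exact ⟨m, e, i, ⟨m, e, rfl, hg⟩, hx⟩

/-- For fixed `x`, membership in the rows is Σ⁰₁, so it propagates by induction inside the model. -/
theorem effOpen_row_mono (hM : IsModelRCA0 M S) (hD : IsCSCSpace S D) (hg : D.IsSeqCode S g)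
    (hmono : ∀ n : M, D.effOpen (row g n) ⊆ D.effOpen (row g (n + 1))) {n n' : M} (hn : n ≤ n') :
    D.effOpen (row g n) ⊆ D.effOpen (row g n') := by
  have := hM.isDiscrete
  have hA : ∀ i, push g (push D.U fun _ => g) i ∈ S :=
    push_mem hg.1 (push_mem hD.mem_U fun _ => hg.1)
  intro x hx
  obtain ⟨d, rfl⟩ := exists_add_of_le hn
  have key (n : M) : x ∈ D.effOpen (row g n) ↔ ∃ q, ∃ m < q, ∃ e < q, ∃ i < q,
      pair (pair n m) e ∈ g ∧ i ∈ decode e ∧ pair x i ∈ D.U := by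
    rw [mem_effOpen_row]
    constructor
    · rintro ⟨m, e, i, H⟩
      refine ⟨m + e + i + 1, m, ?_, e, ?_, i, ?_, H⟩ <;>
        refine lt_of_le_of_lt ?_ (lt_add_one _)
      exacts [le_self_add.trans le_self_add, le_add_self.trans le_self_add, le_add_self]
    · rintro ⟨q, m, -, e, -, i, -, H⟩
      exact ⟨m, e, i, H⟩
  rw [key]
  refine hM.sigma_induction (push n (push x fun _ => 0)) hA (fun q d => ∃ m < q, ∃ e < q, ∃ i < q,
      pair (pair (n + d) m) e ∈ g ∧ i ∈ decode e ∧ pair x i ∈ D.U) ?_ ?_ d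
  · rwa [← key, add_zero]
  · intro d hd
    rw [← key] at hd ⊢
    rw [← add_assoc]
    exact hmono _ hd

theorem exists_effOpen_row_eq (hM : IsModelRCA0 M S) (hD : IsCSCSpace S D)
    (hc : ∀ h, D.IsCode S h → ∃ N : M, D.effOpen h = D.effOpenBelow h N) (hg : D.IsSeqCode S g)
    (hmono : ∀ n : M, D.effOpen (row g n) ⊆ D.effOpen (row g (n + 1))) :
    ∃ N : M, ∀ n > N, D.effOpen (row g n) = D.effOpen (row g N) := by
  have := hM.isDiscrete
  have hA : ∀ i, push g (fun _ => g) i ∈ S := push_mem hg.1 fun _ => hg.1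
  -- `g` read as a function of one variable enumerates all rows together; numbers that are not pairs
  -- get the value `0`, the code of `∅`.
  have hh := hM.bdd_comprehension (fun _ => 0) hA (fun q => q ∈ g ∨ ∃ p < q + 1, q = pair p 0 ∧
    ¬ ∃ n < p + 1, ∃ m < p + 1, p = pair n m)
  set h := {q | q ∈ g ∨ ∃ p < q + 1, q = pair p 0 ∧ ¬ ∃ n < p + 1, ∃ m < p + 1, p = pair n m}
  have pair_lt {n m : M} : n < pair n m + 1 ∧ m < pair n m + 1 :=
    ⟨(le_pair_left n m).trans_lt (lt_add_one _), (le_pair_right n m).trans_lt (lt_add_one _)⟩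
  have mem_pair (n m e : M) : pair (pair n m) e ∈ h ↔ pair (pair n m) e ∈ g := by
    refine ⟨?_, .inl⟩
    rintro (hg | ⟨p, -, hp, hnp⟩)
    · exact hg
    · exact absurd ⟨n, (pair_inj.1 hp).1 ▸ pair_lt.1, m, (pair_inj.1 hp).1 ▸ pair_lt.2,
        (pair_inj.1 hp).1.symm⟩ hnp
  have mem_of_not {p e : M} (hp : ¬ ∃ n m : M, p = pair n m) : pair p e ∈ h ↔ e = 0 := by
    constructor
    · rintro (hpe | ⟨q, -, hq, -⟩)
      · obtain ⟨a, ⟨n, -, m, -, rfl⟩, b, -, hab⟩ := hg.2.1 hpe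
        exact absurd ⟨n, m, (pair_inj.1 hab).1⟩ hp
      · exact (pair_inj.1 hq).2
    · rintro rfl
      exact .inr ⟨p, pair_lt.1, rfl, fun ⟨n, _, m, _, H⟩ => hp ⟨n, m, H⟩⟩
  have hcode : D.IsCode S h := by
    refine ⟨hh, ?_, fun p _ => ?_⟩
    · rintro q (hq | ⟨p, -, rfl, -⟩)
      · obtain ⟨a, -, b, hb, rfl⟩ := hg.2.1 hq
        exact ⟨a, trivial, b, hb, rfl⟩
      · exact ⟨p, trivial, 0, zero_mem_finSubsets _, rfl⟩
    · by_cases hp : ∃ n m : M, p = pair n m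
      · obtain ⟨n, m, rfl⟩ := hp
        simpa only [mem_pair] using hg.2.2 _ ⟨n, trivial, m, trivial, rfl⟩
      · simp only [mem_of_not hp]
        exact ⟨0, rfl, fun _ => id⟩
  obtain ⟨N, hN⟩ := hc h hcode
  refine ⟨N, fun n hn => (effOpen_row_mono hM hD hg hmono hn.le).antisymm' fun x hx => ?_⟩
  obtain ⟨m, e, i, he, hx⟩ := mem_effOpen_row.1 hx
  obtain ⟨p, e, i, hp, he, hi, hx⟩ := hN.subset ⟨_, e, i, (mem_pair n m e).2 he, hx⟩
  by_cases hp' : ∃ n m : M, p = pair n m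
  · obtain ⟨n', m', rfl⟩ := hp'
    -- `n'` is at most `pair n' m' < N`, so row `n'` is contained in row `N`.
    exact effOpen_row_mono hM hD hg hmono ((le_pair_left n' m').trans hp.le)
      (mem_effOpen_row.2 ⟨m', e, i, (mem_pair _ _ _).1 he, hi, hx⟩)
  · rw [(mem_of_not hp').1 he, decode_zero] at hi
    exact absurd hi (Set.notMem_empty i)

theorem exists_eq_effOpenBelow_of_seq (hM : IsModelRCA0 M S)
    (hc : ∀ g, D.IsSeqCode S g →
      (∀ n : M, D.effOpen (row g n) ⊆ D.effOpen (row g (n + 1))) →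
      ∃ N : M, ∀ n > N, D.effOpen (row g n) = D.effOpen (row g N)) (hh : D.IsCode S h) :
    ∃ N : M, D.effOpen h = D.effOpenBelow h N := by
  have := hM.isDiscrete
  have hA : ∀ i, push h (fun _ => h) i ∈ S := push_mem hh.1 fun _ => hh.1
  have pair_lt {n m : M} : n < pair n m + 1 ∧ m < pair n m + 1 :=
    ⟨(le_pair_left n m).trans_lt (lt_add_one _), (le_pair_right n m).trans_lt (lt_add_one _)⟩
  -- Row `n` is `h` cut off at `n` and continued by `0`, so it codes stage `n` of `G_h`.
  have hg := hM.bdd_comprehension (fun _ => 0) hA (fun q => ∃ p < q + 1, ∃ e < q + 1,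
    ∃ n < p + 1, ∃ m < p + 1, p = pair n m ∧ q = pair p e ∧ (m < n ∧ pair m e ∈ h ∨ n ≤ m ∧ e = 0))
  set g := {q | ∃ p < q + 1, ∃ e < q + 1, ∃ n < p + 1, ∃ m < p + 1, p = pair n m ∧ q = pair p e ∧
    (m < n ∧ pair m e ∈ h ∨ n ≤ m ∧ e = 0)}
  have mem_g (n m e : M) : pair (pair n m) e ∈ g ↔ m < n ∧ pair m e ∈ h ∨ n ≤ m ∧ e = 0 := by
    constructor
    · rintro ⟨p, -, e', -, n', -, m', -, rfl, hq, H⟩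
      obtain ⟨hp, rfl⟩ := pair_inj.1 hq
      obtain ⟨rfl, rfl⟩ := pair_inj.1 hp
      exact H
    · exact fun H => ⟨_, pair_lt.1, e, pair_lt.2, n, pair_lt.1, m, pair_lt.2, rfl, rfl, H⟩
  have hcode : D.IsSeqCode S g := by
    refine ⟨hg, ?_, ?_⟩
    · rintro q ⟨p, -, e, -, n, -, m, -, rfl, rfl, H⟩
      refine ⟨_, ⟨n, trivial, m, trivial, rfl⟩, e, ?_, rfl⟩
      rcases H with ⟨-, H⟩ | ⟨-, rfl⟩
      · obtain ⟨a, -, b, hb, hab⟩ := hh.2.1 H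
        exact (pair_inj.1 hab).2 ▸ hb
      · exact zero_mem_finSubsets _
    · rintro _ ⟨n, -, m, -, rfl⟩
      simp only [mem_g]
      rcases lt_or_ge m n with H | H
      · simpa only [H, H.not_ge, true_and, false_and, or_false] using hh.2.2 m trivial
      · simp only [H, H.not_gt, true_and, false_and, false_or]
        exact ⟨0, rfl, fun _ => id⟩
  have row_eq (n : M) : D.effOpen (row g n) = D.effOpenBelow h n := by
    ext x
    rw [mem_effOpen_row]
    constructor
    · rintro ⟨m, e, i, H, hi, hx⟩
      rcases (mem_g n m e).1 H with ⟨hm, he⟩ | ⟨-, rfl⟩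
      · exact ⟨m, e, i, hm, he, hi, hx⟩
      · rw [decode_zero] at hi
        exact absurd hi (Set.notMem_empty i)
    · rintro ⟨m, e, i, hm, he, hx⟩
      exact ⟨m, e, i, (mem_g n m e).2 (.inl ⟨hm, he⟩), hx⟩
  obtain ⟨N, hN⟩ := hc g hcode fun n => by
    simpa only [row_eq] using effOpenBelow_mono D h (lt_add_one n).le
  simp only [row_eq] at hN
  refine ⟨N, (effOpenBelow_subset D h N).antisymm' fun x hx => ?_⟩
  obtain ⟨n, hn⟩ := mem_effOpen_iff.1 hx
  rcases le_or_gt n N with h' | h'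
  · exact effOpenBelow_mono D h h' hn
  · exact hN n h' ▸ hn

theorem effClosed_subset_iff [IsDiscrete M] (hD : IsCSCSpace S D) :
    D.effClosed g ⊆ D.effClosed h ↔ D.effOpen h ⊆ D.effOpen g :=
  Set.sdiff_subset_sdiff_iff_subset (effOpen_subset hD g) (effOpen_subset hD h)

theorem effClosed_eq_iff [IsDiscrete M] (hD : IsCSCSpace S D) :
    D.effClosed g = D.effClosed h ↔ D.effOpen g = D.effOpen h := by
  simp only [Set.Subset.antisymm_iff, effClosed_subset_iff hD, and_comm]

end SpaceData

end Compactness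

end RevMath

theorem proposition3p1 {M : Type*} [CommSemiring M] [LinearOrder M] [IsStrictOrderedRing M]
    (S : Set (Set M)) (hM : RevMath.IsModelRCA0 M S)
    (D : RevMath.SpaceData M) (hD : RevMath.IsCSCSpace S D) :
    List.TFAE [
      ∀ h, D.IsCode S h → D.IsCompactEffOpen S h,
      ∀ h, D.IsCode S h → ∃ N : M, D.effOpen h = D.effOpenBelow h N,
      ∀ Y ∈ S, Y ⊆ D.X → (D.subspace Y).IsCompact S,
      ∀ g, D.IsSeqCode S g →
        (∀ n : M, D.effOpen (RevMath.row g n) ⊆ D.effOpen (RevMath.row g (n + 1))) →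
        ∃ N : M, ∀ n > N, D.effOpen (RevMath.row g n) = D.effOpen (RevMath.row g N),
      ∀ g, D.IsSeqCode S g →
        (∀ n : M, D.effClosed (RevMath.row g n) ⊇ D.effClosed (RevMath.row g (n + 1))) →
        ∃ N : M, ∀ n > N, D.effClosed (RevMath.row g n) = D.effClosed (RevMath.row g N)] := by
  have := hM.isDiscrete
  tfae_have 1 → 2 := fun H h hh =>
    (H h hh h hh subset_rfl).imp fun N hN => hN.antisymm (D.effOpenBelow_subset h N)
  tfae_have 2 → 1 := fun H h _ f hf hhf =>
    (H f hf).imp fun N hN => hhf.trans hN.subset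
  tfae_have 2 → 3 := fun H Y _ _ => RevMath.SpaceData.isCompact_subspace hD H Y
  tfae_have 3 → 2 := fun H h hh =>
    RevMath.SpaceData.exists_eq_effOpenBelow_of_subspaces hM hD H hh
  tfae_have 2 → 4 := fun H g hg hmono =>
    RevMath.SpaceData.exists_effOpen_row_eq hM hD H hg hmono
  tfae_have 4 → 2 := fun H h hh => RevMath.SpaceData.exists_eq_effOpenBelow_of_seq hM H hh
  tfae_have 4 ↔ 5 := forall₂_congr fun g _ => imp_congr
    (forall_congr' fun _ => (RevMath.SpaceData.effClosed_subset_iff hD).symm)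
    (exists_congr fun _ => forall₂_congr fun _ _ => (RevMath.SpaceData.effClosed_eq_iff hD).symm)
  tfae_finish
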